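/- \textbf{Setting.} Let $\mathcal X\subseteq\mathbb R^n$ be closed and convex with non-empty interior. Let $h:\mathbb R^n\to(-\infty,+\infty]$ be proper, lower semicontinuous (lsc) and convex with $\operatorname{dom}h=\mathcal X$, and of Legendre type: $h$ is differentiable and strictly convex on $\operatorname{int}\mathcal X$, and $\|\nabla h(y^k)\|\to\infty$ whenever $(y^k)\subset\operatorname{int}\mathcal X$ converges to a boundary point of $\mathcal X$. Put $D_h(x,y)=h(x)-h(y)-\langle\nabla h(y),x-y\rangle$ for $x\in\mathcal X$, $y\in\operatorname{int}\mathcal X$. Assume that for every $x\in\mathcal X$ the sets $\{y\in\operatorname{int}\mathcal X: D_h(x,y)\le t\}$, $t\in\mathbb R$, are bounded, and that for every sequence $(y^k)\subset\operatorname{int}\mathcal X$, $y^k\to x$ if and only if $D_h(x,y^k)\to0$. Let $g:\mathbb R^n\to(-\infty,+\infty]$ be proper, lsc and convex with $\operatorname{dom}g\cap\operatorname{int}\mathcal X\ne\emptyset$. Let $M\ge1$, $L>0$ and, for $i=1,\dots,M$, let $f_i:\mathcal X\to\mathbb R$ be convex and lsc, differentiable on $\operatorname{int}\mathcal X$, with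 $Lh-f_i$ convex on $\operatorname{int}\mathcal X$. Let $\gamma\in(0,1/L)$. \textbf{Algorithm.} At time $0$ a point $x^0\in\operatorname{int}\mathcal X$ is sent to all $M$ workers. At each iteration $k\ge1$ exactly one worker, $w(k)$, exchanges with the central machine. Let $d_i^k$ be the number of iterations elapsed at time $k$ since worker $i$ last exchanged (with $d_i^k=k$ if it has not exchanged yet), and $D_i^k=d_i^k+d_i^{k-d_i^k-1}+1$, so that $k-D_i^k$ is the time of the second last exchange of worker $i$ (its reception of $x^0$ at time $0$ included); if worker $i$ has not answered yet, $D_i^k=k+1$. The central machine computes $$x^k\in\operatorname*{argmin}_{x\in\mathcal X}\{h(x)+\gamma g(x)+\langle\bar u^k,x\rangle\},\qquad \bar u^k=\frac1M\sum_{i=1}^M u_i^k,\qquad k\ge1,$$ where $u_i^k=\gamma\nabla f_i(x^{k-D_i^k})-\nabla h(x^{k-D_i^k})$ if worker $i$ has answered by time $k$, and $u_i^k=u_i^0$, a given initial vector, otherwise. Epochs start at $k_0=0$ and $k_m=\min\{k: k-D_i^k\ge k_{m-1}\text{ for all }i\}$; iteration $k$ is in epoch $m$ if $k_m\le k<k_{m+1}$.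 Assume that the epoch number of iteration $k$ tends to infinity as $k\to\infty$; the delays may be bounded or not. \textbf{Theorem 1.} Assume that $F=\frac1M\sum_{i=1}^M f_i+g$ has a unique minimizer $x^\star$ over $\mathcal X$. Then: (a) with the initialization $u_i^0=\gamma\nabla f_i(x^0)-\nabla h(x^0)$ for all $i$, the algorithm is well defined: there is exactly one sequence $(x^k)$ of iterates; (b) for any initial vectors $u_1^0,\dots,u_M^0\in\mathbb R^n$ (in particular those in (a)), every sequence $(x^k)$ generated by the algorithm stays in $\operatorname{int}\mathcal X$ and converges to $x^\star$. -/

import Mathlib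

open Filter Topology Set
open scoped InnerProductSpace

noncomputable section

/-! ### Extended-real-valued convex functions -/

/-- The effective domain of an extended-real-valued function. -/
def effDom {E : Type*} (φ : E → EReal) : Set E := {x | φ x < ⊤}

/-- Proper: never `-∞`, and not identically `+∞`. -/
def IsProperFn {E : Type*} (φ : E → EReal) : Prop :=
  (∀ x, φ x ≠ ⊥) ∧ (effDom φ).Nonempty

/-- Convexity of an extended-real-valued function: its epigraph is convex. -/
def IsConvexFn {E : Type*} [AddCommGroup E] [Module ℝ E] (φ : E → EReal) : Prop :=
  Convex ℝ {p : E × ℝ | φ p.1 ≤ (p.2 : EReal)}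

/-- The set of minimizers of `φ` over `X`. -/
def argminOn {E : Type*} (X : Set E) (φ : E → EReal) : Set E :=
  {x | x ∈ X ∧ ∀ y ∈ X, φ x ≤ φ y}

/-! ### Bregman geometry -/

section Bregman

variable {n : ℕ}

/-- The gradient of an extended-real-valued function, meant at interior points of its domain. -/
def grad (h : EuclideanSpace ℝ (Fin n) → EReal) (y : EuclideanSpace ℝ (Fin n)) :
    EuclideanSpace ℝ (Fin n) :=
  gradient (fun z => (h z).toReal) y

/-- The Bregman distance `D_h(x, y)`, meant for `x ∈ dom h` and `y ∈ int (dom h)`. -/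
def bregman (h : EuclideanSpace ℝ (Fin n) → EReal) (x y : EuclideanSpace ℝ (Fin n)) : ℝ :=
  (h x).toReal - (h y).toReal - ⟪grad h y, x - y⟫_ℝ

/-- Legendre type: differentiable and strictly convex on the interior of the domain, with the norm
of the gradient blowing up along interior sequences that converge to a boundary point. -/
structure IsLegendre (h : EuclideanSpace ℝ (Fin n) → EReal) : Prop where
  differentiable : ∀ y ∈ interior (effDom h), DifferentiableAt ℝ (fun z => (h z).toReal) y
  strictConvex : StrictConvexOn ℝ (interior (effDom h)) (fun z => (h z).toReal)
  blowup : ∀ (y : ℕ → EuclideanSpace ℝ (Fin n)) (b : EuclideanSpace ℝ (Fin n)),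
    (∀ k, y k ∈ interior (effDom h)) → b ∈ frontier (effDom h) → Tendsto y atTop (𝓝 b) →
      Tendsto (fun k => ‖grad h (y k)‖) atTop atTop

/-- `h` is a Bregman regularizer with domain `X`. -/
structure IsBregmanRegularizer (X : Set (EuclideanSpace ℝ (Fin n)))
    (h : EuclideanSpace ℝ (Fin n) → EReal) : Prop where
  proper : IsProperFn h
  lsc : LowerSemicontinuous h
  convex : IsConvexFn h
  dom_eq : effDom h = X
  legendre : IsLegendre h

/-- The constraint set `X` is closed and convex with non-empty interior, and `g` is proper, lower
semicontinuous and convex, with a point of its domain in the interior of `X`. -/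
structure ProblemAssumption (X : Set (EuclideanSpace ℝ (Fin n)))
    (g : EuclideanSpace ℝ (Fin n) → EReal) : Prop where
  closed : IsClosed X
  convex : Convex ℝ X
  interior_nonempty : (interior X).Nonempty
  g_proper : IsProperFn g
  g_lsc : LowerSemicontinuous g
  g_convex : IsConvexFn g
  dom_inter : (effDom g ∩ interior X).Nonempty

/-- The real-valued function `f` on `X` is convex and lower semicontinuous on `X`, differentiable
in the interior of `X`, and `L`-smooth relative to `h`. Values of `f` outside `X` play no role. -/
structure IsRelSmooth (X : Set (EuclideanSpace ℝ (Fin n)))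
    (h : EuclideanSpace ℝ (Fin n) → EReal) (L : ℝ) (f : EuclideanSpace ℝ (Fin n) → ℝ) : Prop where
  convex : ConvexOn ℝ X f
  lsc : LowerSemicontinuousOn f X
  differentiable : ∀ y ∈ interior X, DifferentiableAt ℝ f y
  smooth : ConvexOn ℝ (interior X) (fun y => L * (h y).toReal - f y)

/-- Boundedness of the right level sets of `D_h`, and convergence in `D_h` is convergence. -/
structure LevelBoundedLimit (h : EuclideanSpace ℝ (Fin n) → EReal) : Prop where
  level_bounded : ∀ x ∈ effDom h, ∀ t : ℝ,
    Bornology.IsBounded {y | y ∈ interior (effDom h) ∧ bregman h x y ≤ t}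
  limit_iff : ∀ x ∈ effDom h, ∀ y : ℕ → EuclideanSpace ℝ (Fin n),
    (∀ k, y k ∈ interior (effDom h)) →
      (Tendsto y atTop (𝓝 x) ↔ Tendsto (fun k => bregman h x (y k)) atTop (𝓝 0))

/-- The objective `F = (1/M) ∑ f_i + g`. -/
def objective {M : ℕ} (f : Fin M → EuclideanSpace ℝ (Fin n) → ℝ)
    (g : EuclideanSpace ℝ (Fin n) → EReal) (x : EuclideanSpace ℝ (Fin n)) : EReal :=
  (((1 / (M : ℝ)) * ∑ i, f i x : ℝ) : EReal) + g x

end Bregman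

/-! ### Asynchronous schedules

A schedule is a map `w`, where `w k` (for `k ≥ 1`) is the worker that exchanges with the central
machine at iteration `k`; at time `0` the initial point is sent to all workers. -/

section Schedule

variable {M : ℕ}

/-- The time of the last exchange of worker `i` up to time `k` (`0` if it has not answered yet). -/
def lastExchange (w : ℕ → Fin M) (i : Fin M) : ℕ → ℕ
  | 0 => 0
  | k + 1 => if w (k + 1) = i then k + 1 else lastExchange w i k

/-- The delay `d_i^k`: number of iterations since the last exchange of worker `i`. -/
def delay (w : ℕ → Fin M) (i : Fin M) (k : ℕ) : ℕ := k - lastExchange w i k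

/-- The second-order delay `D_i^k = d_i^k + d_i^{k - d_i^k - 1} + 1`. If worker `i` has answered by
time `k`, then `k - D_i^k` is the time of its second last exchange; if it has not, then
`d_i^k = k` and the formula gives `D_i^k = k + 1 > k`. -/
def delay2 (w : ℕ → Fin M) (i : Fin M) (k : ℕ) : ℕ :=
  delay w i k + delay w i (k - delay w i k - 1) + 1

/-- The pair `(m, k_m)` at iteration `k`: the number of the current epoch and its first iteration.
The epoch is incremented as soon as `k_m ≤ k - D_i^k` for all workers `i`. -/
def epochState (w : ℕ → Fin M) : ℕ → ℕ × ℕ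
  | 0 => (0, 0)
  | k + 1 =>
    if ∀ i, (epochState w k).2 + delay2 w i (k + 1) ≤ k + 1 then
      ((epochState w k).1 + 1, k + 1)
    else epochState w k

/-- The number of the epoch that iteration `k` belongs to. -/
def epoch (w : ℕ → Fin M) (k : ℕ) : ℕ := (epochState w k).1

end Schedule

/-! ### The asynchronous Bregman proximal-gradient algorithm -/

section Algorithm

variable {n M : ℕ}

/-- The vector `γ ∇f_i(y) - ∇h(y)` that worker `i` computes from the point `y`. -/
def contribution (f : Fin M → EuclideanSpace ℝ (Fin n) → ℝ)
    (h : EuclideanSpace ℝ (Fin n) → EReal) (γ : ℝ) (i : Fin M) (y : EuclideanSpace ℝ (Fin n)) :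
    EuclideanSpace ℝ (Fin n) :=
  γ • gradient (f i) y - grad h y

/-- The last contribution `u_i^k` of worker `i` held by the central machine at iteration `k`, for
the iterates `x`: it was computed at `x^{k - D_i^k}`, and it is the initial value `u0 i` as long as
worker `i` has not answered. -/
def heldContribution (f : Fin M → EuclideanSpace ℝ (Fin n) → ℝ)
    (h : EuclideanSpace ℝ (Fin n) → EReal) (γ : ℝ) (w : ℕ → Fin M)
    (u0 : Fin M → EuclideanSpace ℝ (Fin n)) (x : ℕ → EuclideanSpace ℝ (Fin n))
    (k : ℕ) (i : Fin M) : EuclideanSpace ℝ (Fin n) :=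
  if delay2 w i k ≤ k then contribution f h γ i (x (k - delay2 w i k)) else u0 i

/-- The aggregate `ū^k = (1/M) ∑ u_i^k`. -/
def aggregate (f : Fin M → EuclideanSpace ℝ (Fin n) → ℝ)
    (h : EuclideanSpace ℝ (Fin n) → EReal) (γ : ℝ) (w : ℕ → Fin M)
    (u0 : Fin M → EuclideanSpace ℝ (Fin n)) (x : ℕ → EuclideanSpace ℝ (Fin n)) (k : ℕ) :
    EuclideanSpace ℝ (Fin n) :=
  (1 / (M : ℝ)) • ∑ i, heldContribution f h γ w u0 x k i

/-- The function `h + γ g + ⟨u, ·⟩` that the central machine minimizes over `X`. -/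
def stepObjective (g h : EuclideanSpace ℝ (Fin n) → EReal) (γ : ℝ)
    (u z : EuclideanSpace ℝ (Fin n)) : EReal :=
  h z + (γ : EReal) * g z + ((⟪u, z⟫_ℝ : ℝ) : EReal)

/-- `x` is a sequence of iterates generated by the algorithm with step size `γ` under the schedule
`w`, from the initial point `x0` and the initial contributions `u0`. -/
def IsAsyncBregman (X : Set (EuclideanSpace ℝ (Fin n)))
    (f : Fin M → EuclideanSpace ℝ (Fin n) → ℝ) (g h : EuclideanSpace ℝ (Fin n) → EReal) (γ : ℝ)
    (w : ℕ → Fin M) (x0 : EuclideanSpace ℝ (Fin n)) (u0 : Fin M → EuclideanSpace ℝ (Fin n))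
    (x : ℕ → EuclideanSpace ℝ (Fin n)) : Prop :=
  x 0 = x0 ∧ ∀ k, 1 ≤ k → x k ∈ argminOn X (stepObjective g h γ (aggregate f h γ w u0 x k))

end Algorithm

end

/-! Convergence rests on one inequality for `a k = D_h(x⋆, x^k)`. Once every worker has answered,
`step_bound` gives `a k + γ (F(x^k) - F(x⋆)) ≤ (1/M) ∑ a (k - D_i^k)`: optimality of the step,
convexity and relative smoothness of the `f_i` and the three-point identity combine, and `γ L < 1`
makes the leftover distances nonnegative, so they can be dropped.

The indices on the right are smaller than `k`, so `a` is bounded. It need not be monotone, and the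
delays need not be bounded, so the argument works with the upper limit `A` of `a`. The indices tend
to infinity because the epochs do, hence the right side is eventually below `A + ε`; at times when
`a k` is close to `A`, the gap `F(x^k) - F(x⋆)` must then be small (`exists_subseq_tendsto_limsup`).
Bounded level sets give a cluster point along these times. By lower semicontinuity it is a
minimizer, hence `x⋆`. The limit condition on `D_h` then forces `A = 0`, so `a` tends to `0` along
the full sequence, and the same condition returns `x^k → x⋆`.

For well-posedness, the gradient blow-up keeps minimizers of a step in the interior, where strict
convexity makes them unique. When all contributions come from interior points, relative smoothness
and the lower bound on `F` leave the step objective bounded below by a positive multiple of a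
Bregman distance plus a constant, which is coercive, so a minimizer exists. -/

/-! ### Finite parts of extended-real convex functions -/

section ExtendedReal

variable {E : Type*} {φ : E → EReal}

lemma IsProperFn.coe_toReal (hφ : IsProperFn φ) {x : E} (hx : x ∈ effDom φ) :
    ((φ x).toReal : EReal) = φ x :=
  EReal.coe_toReal (ne_of_lt hx) (hφ.1 x)

lemma IsConvexFn.convexOn_toReal [AddCommGroup E] [Module ℝ E] (hc : IsConvexFn φ)
    (hφ : IsProperFn φ) : ConvexOn ℝ (effDom φ) (fun x => (φ x).toReal) := by
  have key : ∀ x ∈ effDom φ, ∀ y ∈ effDom φ, ∀ a b : ℝ, 0 ≤ a → 0 ≤ b → a + b = 1 →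
      φ (a • x + b • y) ≤ ((a * (φ x).toReal + b * (φ y).toReal : ℝ) : EReal) := by
    intro x hx y hy a b ha hb hab
    have h1 : ((x, (φ x).toReal) : E × ℝ) ∈ {p : E × ℝ | φ p.1 ≤ (p.2 : EReal)} :=
      (hφ.coe_toReal hx).ge
    have h2 : ((y, (φ y).toReal) : E × ℝ) ∈ {p : E × ℝ | φ p.1 ≤ (p.2 : EReal)} :=
      (hφ.coe_toReal hy).ge
    exact hc h1 h2 ha hb hab
  have hd : Convex ℝ (effDom φ) := fun x hx y hy a b ha hb hab =>
    (key x hx y hy a b ha hb hab).trans_lt (EReal.coe_lt_top _)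
  refine ⟨hd, fun x hx y hy a b ha hb hab => ?_⟩
  have h := key x hx y hy a b ha hb hab
  rw [← hφ.coe_toReal (hd hx hy ha hb hab)] at h
  exact EReal.coe_le_coe_iff.1 h

end ExtendedReal

/-! ### Gradients and convexity -/

section Gradient

variable {E : Type*} [NormedAddCommGroup E] [InnerProductSpace ℝ E] [CompleteSpace E]

lemma DifferentiableAt.hasDerivAt_along {φ : E → ℝ} {y : E} (hd : DifferentiableAt ℝ φ y) (v : E) :
    HasDerivAt (fun t : ℝ => φ (y + t • v)) ⟪gradient φ y, v⟫_ℝ 0 := by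
  have h1 : HasFDerivAt φ (InnerProductSpace.toDual ℝ E (gradient φ y)) (y + (0 : ℝ) • v) := by
    simpa using hasGradientAt_iff_hasFDerivAt.1 hd.hasGradientAt
  have h2 : HasDerivAt (fun t : ℝ => y + t • v) v 0 := by
    simpa using ((hasDerivAt_id (0 : ℝ)).smul_const v).const_add y
  have h3 := h1.comp_hasDerivAt (0 : ℝ) h2
  rwa [InnerProductSpace.toDual_apply_apply] at h3

/-- Convexity bounds the difference quotients at `y` towards `x` by `φ x - φ y`, and their one-sided
limit is the directional derivative. Differentiability is needed at `y` only, so `x` may lie on the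
boundary. -/
lemma ConvexOn.add_inner_gradient_le {φ : E → ℝ} {s : Set E} (hφ : ConvexOn ℝ s φ) {x y : E}
    (hx : x ∈ s) (hy : y ∈ s) (hd : DifferentiableAt ℝ φ y) :
    φ y + ⟪gradient φ y, x - y⟫_ℝ ≤ φ x := by
  have ht := (hd.hasDerivAt_along (x - y)).tendsto_slope_zero_right
  have hle : ⟪gradient φ y, x - y⟫_ℝ ≤ φ x - φ y := by
    refine le_of_tendsto ht ?_
    filter_upwards [Ioo_mem_nhdsGT (zero_lt_one' ℝ)] with t ht
    have h := hφ.2 hy hx (sub_nonneg.2 ht.2.le) ht.1.le (by ring)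
    have e : (1 - t) • y + t • x = y + t • (x - y) := by module
    rw [e] at h
    simp only [smul_eq_mul, zero_add, zero_smul, add_zero] at h ⊢
    rw [inv_mul_le_iff₀ ht.1]
    linarith
  linarith

lemma gradient_const_mul_sub {φ ψ : E → ℝ} {y : E} (c : ℝ) (hφ : DifferentiableAt ℝ φ y)
    (hψ : DifferentiableAt ℝ ψ y) :
    gradient (fun z => c * φ z - ψ z) y = c • gradient φ y - gradient ψ y := by
  apply HasGradientAt.gradient
  rw [hasGradientAt_iff_hasFDerivAt]
  have h1 := hasGradientAt_iff_hasFDerivAt.1 hφ.hasGradientAt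
  have h2 := hasGradientAt_iff_hasFDerivAt.1 hψ.hasGradientAt
  have h3 := (h1.const_mul c).sub h2
  rw [map_sub, map_smul]
  exact h3

end Gradient

/-! ### Bregman distance and relative smoothness -/

section Regularizer

variable {n : ℕ} {X : Set (EuclideanSpace ℝ (Fin n))} {h : EuclideanSpace ℝ (Fin n) → EReal}

namespace IsBregmanRegularizer

lemma coe_toReal (hreg : IsBregmanRegularizer X h) {x : EuclideanSpace ℝ (Fin n)} (hx : x ∈ X) :
    ((h x).toReal : EReal) = h x :=
  hreg.proper.coe_toReal (by rwa [hreg.dom_eq])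

lemma convexOn (hreg : IsBregmanRegularizer X h) : ConvexOn ℝ X (fun x => (h x).toReal) := by
  have := hreg.convex.convexOn_toReal hreg.proper
  rwa [hreg.dom_eq] at this

lemma differentiableAt (hreg : IsBregmanRegularizer X h) {y : EuclideanSpace ℝ (Fin n)}
    (hy : y ∈ interior X) : DifferentiableAt ℝ (fun z => (h z).toReal) y :=
  hreg.legendre.differentiable y (by rwa [hreg.dom_eq])

lemma strictConvexOn (hreg : IsBregmanRegularizer X h) :
    StrictConvexOn ℝ (interior X) (fun z => (h z).toReal) := by
  have := hreg.legendre.strictConvex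
  rwa [hreg.dom_eq] at this

lemma bregman_nonneg (hreg : IsBregmanRegularizer X h) {x y : EuclideanSpace ℝ (Fin n)}
    (hx : x ∈ X) (hy : y ∈ interior X) : 0 ≤ bregman h x y := by
  have := hreg.convexOn.add_inner_gradient_le hx (interior_subset hy) (hreg.differentiableAt hy)
  simp only [bregman, grad]
  linarith

/-- The Bregman distance to a fixed point grows at most linearly along segments from that point. -/
lemma bregman_segment_le (hreg : IsBregmanRegularizer X h) {x y : EuclideanSpace ℝ (Fin n)}
    (hx : x ∈ X) (hy : y ∈ X) {t : ℝ} (ht : t ∈ Icc (0 : ℝ) 1) :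
    bregman h (y + t • (x - y)) y ≤ t * bregman h x y := by
  have hc := hreg.convexOn.2 hy hx (sub_nonneg.2 ht.2) ht.1 (by ring)
  have e : (1 - t) • y + t • x = y + t • (x - y) := by module
  rw [e] at hc
  simp only [smul_eq_mul] at hc
  simp only [bregman, add_sub_cancel_left, inner_smul_right]
  linarith

/-- At the midpoint of `x` and `y` the distance to `y` is nonnegative, and by strict convexity it is
less than half of `bregman h x y`. -/
lemma bregman_pos (hreg : IsBregmanRegularizer X h) {x y : EuclideanSpace ℝ (Fin n)}
    (hx : x ∈ interior X) (hy : y ∈ interior X) (hxy : x ≠ y) : 0 < bregman h x y := by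
  obtain ⟨hconv, hstrict⟩ := hreg.strictConvexOn
  have hs := hstrict hy hx hxy.symm (one_half_pos (α := ℝ)) one_half_pos (add_halves 1)
  have hm := hconv hy hx (one_half_pos (α := ℝ)).le one_half_pos.le (add_halves 1)
  have h0 := hreg.bregman_nonneg (interior_subset hm) hy
  have e : (1 / 2 : ℝ) • y + (1 / 2 : ℝ) • x - y = (1 / 2 : ℝ) • (x - y) := by module
  simp only [bregman, e, inner_smul_right, smul_eq_mul] at h0 hs ⊢
  linarith

/-- The Bregman distance to a fixed interior point is coercive. -/
lemma bregman_coercive (hreg : IsBregmanRegularizer X h) {y : EuclideanSpace ℝ (Fin n)}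
    (hy : y ∈ interior X) :
    ∃ c > 0, ∃ r > 0, ∀ x ∈ X, r ≤ ‖x - y‖ → c * ‖x - y‖ ≤ bregman h x y := by
  obtain ⟨r, hr, hball⟩ := Metric.nhds_basis_closedBall.mem_iff.1 (isOpen_interior.mem_nhds hy)
  have hsub : Metric.sphere y r ⊆ interior X := Metric.sphere_subset_closedBall.trans hball
  have hz : ∀ x, r ≤ ‖x - y‖ → y + (r / ‖x - y‖) • (x - y) ∈ Metric.sphere y r := by
    intro x hx
    have : 0 < ‖x - y‖ := hr.trans_le hx
    rw [mem_sphere_iff_norm, add_sub_cancel_left, norm_smul, Real.norm_of_nonneg (by positivity)]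
    field_simp
  -- The sphere is empty in dimension zero, where no point is at distance `r` or more and the bound
  -- is vacuous.
  rcases (Metric.sphere y r).eq_empty_or_nonempty with he | hne
  · refine ⟨1, one_pos, r, hr, fun x _ hx => ?_⟩
    have := hz x hx
    rw [he] at this
    exact this.elim
  · have hcont : ContinuousOn (fun x => bregman h x y) (Metric.sphere y r) := by
      unfold bregman
      refine ContinuousOn.sub (ContinuousOn.sub (fun x hx => ?_) continuousOn_const) (by fun_prop)
      exact (hreg.differentiableAt (hsub hx)).continuousAt.continuousWithinAt
    obtain ⟨z, hzs, hzmin⟩ := (isCompact_sphere y r).exists_isMinOn hne hcont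
    have hδ : 0 < bregman h z y := by
      refine hreg.bregman_pos (hsub hzs) hy ?_
      rintro rfl
      simp at hzs
      exact hr.ne hzs
    -- The slope is the minimum over the sphere divided by its radius; `bregman_segment_le` carries
    -- it outwards along rays from `y`.
    refine ⟨bregman h z y / r, by positivity, r, hr, fun x hx hxr => ?_⟩
    have hpos : 0 < ‖x - y‖ := hr.trans_le hxr
    have h1 : bregman h z y ≤ _ := hzmin (hz x hxr)
    have h2 := hreg.bregman_segment_le hx (interior_subset hy) (t := r / ‖x - y‖)
      ⟨by positivity, (div_le_one hpos).2 hxr⟩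
    have h3 := h1.trans h2
    rw [div_mul_eq_mul_div, le_div_iff₀ hpos] at h3
    rw [div_mul_eq_mul_div, div_le_iff₀ hr]
    linarith

lemma three_point (x y z : EuclideanSpace ℝ (Fin n)) :
    ⟪grad h y - grad h z, x - y⟫_ℝ = bregman h x z - bregman h x y - bregman h y z := by
  simp only [bregman, inner_sub_left, inner_sub_right]
  ring

end IsBregmanRegularizer

lemma IsRelSmooth.descent_interior (hreg : IsBregmanRegularizer X h) {L : ℝ}
    {f : EuclideanSpace ℝ (Fin n) → ℝ} (hf : IsRelSmooth X h L f) {x y : EuclideanSpace ℝ (Fin n)}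
    (hx : x ∈ interior X) (hy : y ∈ interior X) :
    f x ≤ f y + ⟪gradient f y, x - y⟫_ℝ + L * bregman h x y := by
  have hdh := hreg.differentiableAt hy
  have hdf := hf.differentiable y hy
  have hi := hf.smooth.add_inner_gradient_le hx hy ((hdh.const_mul L).sub hdf)
  rw [gradient_const_mul_sub L hdh hdf, inner_sub_left, real_inner_smul_left] at hi
  simp only [bregman, grad]
  linarith

/-- `L h - f` is convex on the interior only, so a boundary point `x` is approached along the
segment from `y`: lower semicontinuity of `f` controls the left side, and `bregman_segment_le` the
right. -/
lemma IsRelSmooth.descent (hX : Convex ℝ X) (hreg : IsBregmanRegularizer X h) {L : ℝ} (hL : 0 ≤ L)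
    {f : EuclideanSpace ℝ (Fin n) → ℝ} (hf : IsRelSmooth X h L f) {x y : EuclideanSpace ℝ (Fin n)}
    (hx : x ∈ X) (hy : y ∈ interior X) :
    f x ≤ f y + ⟪gradient f y, x - y⟫_ℝ + L * bregman h x y := by
  have hseg : ∀ t ∈ Ico (0 : ℝ) 1, y + t • (x - y) ∈ interior X := by
    intro t ht
    have := hX.combo_interior_closure_mem_interior hy (subset_closure hx) (sub_pos.2 ht.2) ht.1
      (by ring)
    convert this using 1
    module
  have hev : ∀ᶠ t in 𝓝[<] (1 : ℝ), t ∈ Ico (0 : ℝ) 1 :=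
    Ico_mem_nhdsLT one_pos
  have hcurve : Tendsto (fun t : ℝ => y + t • (x - y)) (𝓝[<] 1) (𝓝[X] x) := by
    refine tendsto_nhdsWithin_iff.2 ⟨?_, hev.mono fun t ht => interior_subset (hseg t ht)⟩
    have : ContinuousAt (fun t : ℝ => y + t • (x - y)) 1 := by fun_prop
    have h1 := this.tendsto
    simp only [one_smul, add_sub_cancel] at h1
    exact h1.mono_left nhdsWithin_le_nhds
  refine le_of_forall_lt_imp_le_of_dense fun c hc => ?_
  have hlt : ∀ᶠ t in 𝓝[<] (1 : ℝ), c < f (y + t • (x - y)) := hcurve.eventually (hf.lsc x hx c hc)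
  have hub : ∀ᶠ t in 𝓝[<] (1 : ℝ),
      c < f y + t * (⟪gradient f y, x - y⟫_ℝ + L * bregman h x y) := by
    filter_upwards [hlt, hev] with t h1 h2
    have h3 := hf.descent_interior hreg (hseg t h2) hy
    have h4 := mul_le_mul_of_nonneg_left
      (hreg.bregman_segment_le hx (interior_subset hy) (Ico_subset_Icc_self h2)) hL
    rw [add_sub_cancel_left, inner_smul_right] at h3
    linarith
  have hlim : Tendsto (fun t : ℝ => f y + t * (⟪gradient f y, x - y⟫_ℝ + L * bregman h x y))
      (𝓝[<] 1) (𝓝 (f y + 1 * (⟪gradient f y, x - y⟫_ℝ + L * bregman h x y))) :=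
    ((continuous_const.add (continuous_id.mul continuous_const)).tendsto (1 : ℝ)).mono_left
      nhdsWithin_le_nhds
  have := ge_of_tendsto hlim (hub.mono fun _ => le_of_lt)
  linarith

end Regularizer

/-! ### The central step: location, uniqueness and existence of its minimizer -/

section Step

variable {n M : ℕ} {X : Set (EuclideanSpace ℝ (Fin n))} {f : Fin M → EuclideanSpace ℝ (Fin n) → ℝ}
  {g h : EuclideanSpace ℝ (Fin n) → EReal} {L γ : ℝ}

/-- The real-valued objective on the domain of `g`. -/
noncomputable def realObjective (f : Fin M → EuclideanSpace ℝ (Fin n) → ℝ)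
    (g : EuclideanSpace ℝ (Fin n) → EReal) (x : EuclideanSpace ℝ (Fin n)) : ℝ :=
  1 / (M : ℝ) * ∑ i, f i x + (g x).toReal

/-- The real-valued step objective on the intersection of the domains of `g` and `h`. -/
noncomputable def realStepObjective (g h : EuclideanSpace ℝ (Fin n) → EReal) (γ : ℝ)
    (u z : EuclideanSpace ℝ (Fin n)) : ℝ :=
  (h z).toReal + γ * (g z).toReal + ⟪u, z⟫_ℝ

lemma objective_eq_coe (hg : IsProperFn g) {x : EuclideanSpace ℝ (Fin n)} (hx : x ∈ effDom g) :
    objective f g x = (realObjective f g x : EReal) := by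
  rw [objective, ← hg.coe_toReal hx, realObjective, EReal.coe_add]

lemma objective_eq_top {x : EuclideanSpace ℝ (Fin n)} (hx : x ∉ effDom g) :
    objective f g x = ⊤ := by
  have : g x = ⊤ := not_lt_top_iff.1 hx
  rw [objective, this, EReal.coe_add_top]

lemma stepObjective_eq_coe (hreg : IsBregmanRegularizer X h) (hg : IsProperFn g)
    {u z : EuclideanSpace ℝ (Fin n)} (hzX : z ∈ X) (hz : z ∈ effDom g) :
    stepObjective g h γ u z = (realStepObjective g h γ u z : EReal) := by
  rw [stepObjective, ← hg.coe_toReal hz, ← hreg.coe_toReal hzX, realStepObjective, EReal.coe_add,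
    EReal.coe_add, EReal.coe_mul]

lemma stepObjective_eq_top (hreg : IsBregmanRegularizer X h) (hγ : 0 < γ)
    {u z : EuclideanSpace ℝ (Fin n)} (hzX : z ∈ X) (hz : z ∉ effDom g) :
    stepObjective g h γ u z = ⊤ := by
  have : g z = ⊤ := not_lt_top_iff.1 hz
  rw [stepObjective, this, EReal.coe_mul_top_of_pos hγ, ← hreg.coe_toReal hzX, EReal.coe_add_top,
    EReal.top_add_coe]

/-- Minimizing an extended-real-valued function is minimizing its finite part. -/
lemma mem_argminOn_iff_real {E : Type*} {S T : Set E} {φ : E → EReal} {ψ : E → ℝ}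
    (hcoe : ∀ x ∈ S, x ∈ T → φ x = (ψ x : EReal)) (htop : ∀ x ∈ S, x ∉ T → φ x = ⊤)
    (hne : (T ∩ S).Nonempty) {x : E} :
    x ∈ argminOn S φ ↔ x ∈ S ∧ x ∈ T ∧ ∀ y ∈ S, y ∈ T → ψ x ≤ ψ y := by
  constructor
  · rintro ⟨hxS, hmin⟩
    have hxT : x ∈ T := by
      by_contra hxT
      obtain ⟨p, hpT, hpS⟩ := hne
      have := hmin p hpS
      rw [htop x hxS hxT, hcoe p hpS hpT] at this
      exact (EReal.coe_lt_top _).not_ge this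
    refine ⟨hxS, hxT, fun y hyS hyT => ?_⟩
    have := hmin y hyS
    rwa [hcoe x hxS hxT, hcoe y hyS hyT, EReal.coe_le_coe_iff] at this
  · rintro ⟨hxS, hxT, hmin⟩
    refine ⟨hxS, fun y hyS => ?_⟩
    by_cases hyT : y ∈ T
    · rw [hcoe x hxS hxT, hcoe y hyS hyT, EReal.coe_le_coe_iff]
      exact hmin y hyS hyT
    · rw [htop y hyS hyT]
      exact le_top

lemma ProblemAssumption.dom_nonempty (hpb : ProblemAssumption X g) : (effDom g ∩ X).Nonempty :=
  hpb.dom_inter.mono (inter_subset_inter_right _ interior_subset)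

lemma mem_argminOn_objective_iff (hpb : ProblemAssumption X g) {x : EuclideanSpace ℝ (Fin n)} :
    x ∈ argminOn X (objective f g) ↔ x ∈ X ∧ x ∈ effDom g ∧
      ∀ y ∈ X, y ∈ effDom g → realObjective f g x ≤ realObjective f g y :=
  mem_argminOn_iff_real (fun _ _ hx => objective_eq_coe hpb.g_proper hx)
    (fun _ _ hx => objective_eq_top hx) hpb.dom_nonempty

lemma mem_argminOn_stepObjective_iff (hpb : ProblemAssumption X g)
    (hreg : IsBregmanRegularizer X h) (hγ : 0 < γ) {u z : EuclideanSpace ℝ (Fin n)} :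
    z ∈ argminOn X (stepObjective g h γ u) ↔ z ∈ X ∧ z ∈ effDom g ∧
      ∀ y ∈ X, y ∈ effDom g → realStepObjective g h γ u z ≤ realStepObjective g h γ u y :=
  mem_argminOn_iff_real (fun _ hxX hx => stepObjective_eq_coe hreg hpb.g_proper hxX hx)
    (fun _ hxX hx => stepObjective_eq_top hreg hγ hxX hx) hpb.dom_nonempty

/-- Addition on `EReal` is discontinuous only where `⊤` meets `⊥`; properness of `g` and `h`
excludes this. -/
lemma lowerSemicontinuous_stepObjective (hpb : ProblemAssumption X g)
    (hreg : IsBregmanRegularizer X h) (hγ : 0 < γ) (u : EuclideanSpace ℝ (Fin n)) :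
    LowerSemicontinuous (stepObjective g h γ u) := by
  have hγ' : (0 : EReal) < (γ : EReal) := EReal.coe_pos.2 hγ
  have hbot : ∀ z, (γ : EReal) * g z ≠ ⊥ := by
    intro z hz
    by_cases h' : z ∈ effDom g
    · rw [← hpb.g_proper.coe_toReal h', ← EReal.coe_mul] at hz
      exact EReal.coe_ne_bot _ hz
    · have hz' : g z = ⊤ := not_lt_top_iff.1 h'
      rw [hz', EReal.coe_mul_top_of_pos hγ] at hz
      exact top_ne_bot hz
  have hmul : Continuous (fun a : EReal => (γ : EReal) * a) := by
    refine continuous_iff_continuousAt.2 fun a => ?_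
    have h1 : ContinuousAt (fun p : EReal × EReal => p.1 * p.2) ((γ : EReal), a) :=
      EReal.continuousAt_mul (Or.inl hγ'.ne') (Or.inl hγ'.ne') (Or.inl (EReal.coe_ne_bot _))
        (Or.inl (EReal.coe_ne_top _))
    exact h1.comp (f := fun a : EReal => ((γ : EReal), a)) (by fun_prop)
  have h1 : LowerSemicontinuous (fun z => (γ : EReal) * g z) :=
    hmul.comp_lowerSemicontinuous hpb.g_lsc fun a b hab => mul_le_mul_of_nonneg_left hab hγ'.le
  have h2 : LowerSemicontinuous (fun z => h z + (γ : EReal) * g z) :=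
    hreg.lsc.add' h1 fun z => EReal.continuousAt_add (Or.inr (hbot z)) (Or.inl (hreg.proper.1 z))
  have h3 : LowerSemicontinuous (fun z => ((⟪u, z⟫_ℝ : ℝ) : EReal)) :=
    (continuous_coe_real_ereal.comp (by fun_prop)).lowerSemicontinuous
  exact h2.add' h3 fun z => EReal.continuousAt_add (Or.inr (EReal.coe_ne_bot _))
    (Or.inr (EReal.coe_ne_top _))

lemma ProblemAssumption.toReal_segment_le (hpb : ProblemAssumption X g)
    {x z : EuclideanSpace ℝ (Fin n)} (hx : x ∈ effDom g) (hz : z ∈ effDom g) {t : ℝ}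
    (ht : t ∈ Icc (0 : ℝ) 1) :
    z + t • (x - z) ∈ effDom g ∧
      (g (z + t • (x - z))).toReal ≤ (1 - t) * (g z).toReal + t * (g x).toReal := by
  obtain ⟨hd, hc⟩ := hpb.g_convex.convexOn_toReal hpb.g_proper
  have e : (1 - t) • z + t • x = z + t • (x - z) := by module
  have h1 := hd hz hx (sub_nonneg.2 ht.2) ht.1 (by ring)
  have h2 := hc hz hx (sub_nonneg.2 ht.2) ht.1 (by ring)
  rw [e] at h1 h2
  exact ⟨h1, h2⟩

/-- The blow-up of the gradient of `h` keeps the minimizers of a step in the interior. -/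
lemma argminOn_stepObjective_subset_interior (hpb : ProblemAssumption X g)
    (hreg : IsBregmanRegularizer X h) (hγ : 0 < γ) (u : EuclideanSpace ℝ (Fin n)) :
    argminOn X (stepObjective g h γ u) ⊆ interior X := by
  intro z hz
  obtain ⟨hzX, hzg, hmin⟩ := (mem_argminOn_stepObjective_iff hpb hreg hγ).1 hz
  by_contra hzi
  obtain ⟨p, hpg, hpi⟩ := hpb.dom_inter
  set t : ℕ → ℝ := fun k => 1 / ((k : ℝ) + 1) with ht_def
  have htpos : ∀ k, 0 < t k := fun k => Nat.one_div_pos_of_nat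
  have htle : ∀ k, t k ≤ 1 := fun k => by
    rw [ht_def]
    exact (div_le_one (by positivity)).2 (by linarith [(Nat.cast_nonneg k : (0 : ℝ) ≤ k)])
  set y : ℕ → EuclideanSpace ℝ (Fin n) := fun k => z + t k • (p - z) with hy_def
  have hyi : ∀ k, y k ∈ interior X := fun k =>
    hpb.convex.add_smul_sub_mem_interior' (subset_closure hzX) hpi ⟨htpos k, htle k⟩
  have hyz : Tendsto y atTop (𝓝 z) := by
    have : Tendsto t atTop (𝓝 0) := tendsto_one_div_add_atTop_nhds_zero_nat
    simpa using (this.smul_const (p - z)).const_add z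
  have hfr : z ∈ frontier X := ⟨subset_closure hzX, hzi⟩
  have hblow : Tendsto (fun k => ‖grad h (y k)‖) atTop atTop :=
    hreg.legendre.blowup y z (by rwa [hreg.dom_eq]) (by rwa [hreg.dom_eq]) hyz
  obtain ⟨ε, hε, hball⟩ := Metric.nhds_basis_closedBall.mem_iff.1 (isOpen_interior.mem_nhds hpi)
  obtain ⟨C, hC⟩ := (isCompact_closedBall p ε).bddAbove_image
    (f := fun q => (h q).toReal)
    (fun q hq => (hreg.differentiableAt (hball hq)).continuousAt.continuousWithinAt)
  have hlow : ∀ᶠ k in atTop, (h z).toReal - 1 < (h (y k)).toReal := by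
    have hlt : (((h z).toReal - 1 : ℝ) : EReal) < h z := by
      rw [← hreg.coe_toReal hzX, EReal.toReal_coe, EReal.coe_lt_coe_iff]
      linarith
    filter_upwards [hyz.eventually (hreg.lsc z _ hlt)] with k hk
    rw [← hreg.coe_toReal (interior_subset (hyi k))] at hk
    exact EReal.coe_lt_coe_iff.1 hk
  -- Along the segment from `z` to `p`, the terms other than `h` grow by at most `t * A`.
  set A : ℝ := γ * ((g p).toReal - (g z).toReal) + ⟪u, p - z⟫_ℝ with hA
  obtain ⟨k, hk1, hk2⟩ := ((hblow.eventually_gt_atTop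
    (max 0 ((C - (h z).toReal + 1 + |A|) / ε))).and hlow).exists
  have hpos : 0 < ‖grad h (y k)‖ := (le_max_left _ _).trans_lt hk1
  have hbig := (le_max_right _ _).trans_lt hk1
  rw [div_lt_iff₀ hε] at hbig
  -- Moving from `p` by `ε` in the gradient direction makes the gradient inequality at `y k` produce
  -- the term `ε * ‖grad h (y k)‖`, while `h` stays below `C` there.
  have hq : p + (ε / ‖grad h (y k)‖) • grad h (y k) ∈ Metric.closedBall p ε := by
    rw [mem_closedBall_iff_norm, add_sub_cancel_left, norm_smul,
      Real.norm_of_nonneg (by positivity), div_mul_cancel₀ _ hpos.ne']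
  have hqC : (h (p + (ε / ‖grad h (y k)‖) • grad h (y k))).toReal ≤ C :=
    hC (mem_image_of_mem _ hq)
  have hyX := interior_subset (hyi k)
  have g1 := hreg.convexOn.add_inner_gradient_le (interior_subset (hball hq)) hyX
    (hreg.differentiableAt (hyi k))
  have g2 := hreg.convexOn.add_inner_gradient_le hzX hyX (hreg.differentiableAt (hyi k))
  change _ + ⟪grad h (y k), _⟫_ℝ ≤ _ at g1 g2
  have e1 : p + (ε / ‖grad h (y k)‖) • grad h (y k) - y k =
      (ε / ‖grad h (y k)‖) • grad h (y k) + (1 - t k) • (p - z) := by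
    simp only [hy_def]; module
  have e2 : z - y k = (-t k) • (p - z) := by simp only [hy_def]; module
  rw [e1, inner_add_right, inner_smul_right, inner_smul_right, real_inner_self_eq_norm_sq] at g1
  rw [e2, inner_smul_right] at g2
  have e3 : ε / ‖grad h (y k)‖ * ‖grad h (y k)‖ ^ 2 = ‖grad h (y k)‖ * ε := by
    field_simp
  rw [e3] at g1
  obtain ⟨hyg, hgy⟩ := hpb.toReal_segment_le hpg hzg (t := t k) ⟨(htpos k).le, htle k⟩
  have hm := hmin (y k) hyX hyg
  simp only [realStepObjective] at hm
  have e4 : ⟪u, y k⟫_ℝ = ⟪u, z⟫_ℝ + t k * ⟪u, p - z⟫_ℝ := by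
    simp only [hy_def, inner_add_right, inner_smul_right]
  rw [e4] at hm
  have hgy' := mul_le_mul_of_nonneg_left hgy hγ.le
  -- Minimality of `z` bounds the descent of `h` towards `p` by `A`. With `g1` this bounds `‖grad h
  -- (y k)‖ * ε` by `C - h z + 1 + |A|`, against the choice of `k`.
  have h5 : t k * (-⟪grad h (y k), p - z⟫_ℝ) ≤ t k * A := by
    rw [hA]
    simp only [hy_def] at hm g2 ⊢
    linarith
  have h6 := le_of_mul_le_mul_left h5 (htpos k)
  have h7 : (1 - t k) * (-⟪grad h (y k), p - z⟫_ℝ) ≤ (1 - t k) * |A| :=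
    mul_le_mul_of_nonneg_left (h6.trans (le_abs_self A)) (sub_nonneg.2 (htle k))
  have h8 : (1 - t k) * |A| ≤ |A| :=
    mul_le_of_le_one_left (abs_nonneg A) (by linarith [htpos k])
  linarith

/-- First-order optimality of a step. -/
lemma step_optimality (hpb : ProblemAssumption X g) (hreg : IsBregmanRegularizer X h) (hγ : 0 < γ)
    {u z x : EuclideanSpace ℝ (Fin n)} (hz : z ∈ argminOn X (stepObjective g h γ u)) (hx : x ∈ X)
    (hxg : x ∈ effDom g) :
    γ * ((g z).toReal - (g x).toReal) ≤ ⟪u + grad h z, x - z⟫_ℝ := by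
  have hzi := argminOn_stepObjective_subset_interior hpb hreg hγ u hz
  obtain ⟨hzX, hzg, hmin⟩ := (mem_argminOn_stepObjective_iff hpb hreg hγ).1 hz
  have ht := ((hreg.differentiableAt hzi).hasDerivAt_along (x - z)).tendsto_slope_zero_right
  have hle : γ * ((g z).toReal - (g x).toReal) - ⟪u, x - z⟫_ℝ ≤ ⟪grad h z, x - z⟫_ℝ := by
    refine ge_of_tendsto ht ?_
    filter_upwards [Ioo_mem_nhdsGT (zero_lt_one' ℝ)] with t ht
    obtain ⟨h1, h2⟩ := hpb.toReal_segment_le hxg hzg (Ioo_subset_Icc_self ht)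
    have hX := hpb.convex hzX hx (sub_nonneg.2 ht.2.le) ht.1.le (by ring)
    have e : (1 - t) • z + t • x = z + t • (x - z) := by module
    rw [e] at hX
    have h3 := hmin _ hX h1
    simp only [realStepObjective, inner_add_right, inner_smul_right] at h3
    have h4 := mul_le_mul_of_nonneg_left h2 hγ.le
    simp only [smul_eq_mul, zero_add, zero_smul, add_zero]
    rw [le_inv_mul_iff₀ ht.1]
    linarith
  rw [inner_add_left]
  linarith

/-- Adding the optimality conditions of two minimizers gives `D_h(z, z') + D_h(z', z) ≤ 0`. Strict
convexity is available because both are interior. -/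
lemma argminOn_stepObjective_subsingleton (hpb : ProblemAssumption X g)
    (hreg : IsBregmanRegularizer X h) (hγ : 0 < γ) (u : EuclideanSpace ℝ (Fin n)) :
    (argminOn X (stepObjective g h γ u)).Subsingleton := by
  intro z hz z' hz'
  by_contra hne
  have hzi := argminOn_stepObjective_subset_interior hpb hreg hγ u hz
  have hzi' := argminOn_stepObjective_subset_interior hpb hreg hγ u hz'
  have h1 := step_optimality hpb hreg hγ hz hz'.1
    ((mem_argminOn_stepObjective_iff hpb hreg hγ).1 hz').2.1
  have h2 := step_optimality hpb hreg hγ hz' hz.1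
    ((mem_argminOn_stepObjective_iff hpb hreg hγ).1 hz).2.1
  have h3 := hreg.bregman_pos hzi hzi' hne
  have h4 := hreg.bregman_pos hzi' hzi (Ne.symm hne)
  simp only [bregman, inner_add_left, inner_sub_right] at h1 h2 h3 h4
  linarith

lemma inner_average_eq (hM : 0 < M) (v : Fin M → EuclideanSpace ℝ (Fin n))
    (x : EuclideanSpace ℝ (Fin n)) :
    (M : ℝ) * ⟪(1 / (M : ℝ)) • ∑ i, v i, x⟫_ℝ = ∑ i, ⟪v i, x⟫_ℝ := by
  have : (M : ℝ) ≠ 0 := by positivity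
  rw [real_inner_smul_left, sum_inner]
  field_simp

/-- The one-step estimate of the averaged Bregman proximal-gradient step. -/
lemma step_bound (hM : 0 < M) (hL : 0 < L) (hpb : ProblemAssumption X g)
    (hreg : IsBregmanRegularizer X h) (hf : ∀ i, IsRelSmooth X h L (f i)) (hγ : 0 < γ)
    {y : Fin M → EuclideanSpace ℝ (Fin n)} (hy : ∀ i, y i ∈ interior X)
    {x z : EuclideanSpace ℝ (Fin n)}
    (hz : z ∈ argminOn X (stepObjective g h γ ((1 / (M : ℝ)) • ∑ i, contribution f h γ i (y i))))
    (hx : x ∈ X) (hxg : x ∈ effDom g) :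
    bregman h x z + γ * (realObjective f g z - realObjective f g x) +
      (1 - γ * L) * (1 / (M : ℝ) * ∑ i, bregman h z (y i)) ≤
        1 / (M : ℝ) * ∑ i, bregman h x (y i) := by
  have hM' : (0 : ℝ) < M := by exact_mod_cast hM
  have hopt := step_optimality hpb hreg hγ hz hx hxg
  have hzX := hz.1
  -- Convexity of `f i` is used towards `x`, the descent inequality towards `z`. The last term is
  -- independent of `i` and cancels against the optimality condition.
  have hi : ∀ i, ⟪contribution f h γ i (y i), x - z⟫_ℝ ≤
      γ * (f i x - f i z) + bregman h x (y i) - bregman h x z - (1 - γ * L) * bregman h z (y i)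
        - ⟪grad h z, x - z⟫_ℝ := by
    intro i
    have h1 := (hf i).convex.add_inner_gradient_le hx (interior_subset (hy i))
      ((hf i).differentiable _ (hy i))
    have h2 := (hf i).descent hpb.convex hreg hL.le hzX (hy i)
    have h3 := IsBregmanRegularizer.three_point (h := h) x z (y i)
    have h4 : γ * ⟪gradient (f i) (y i), x - z⟫_ℝ ≤ γ * (f i x - f i z + L * bregman h z (y i)) := by
      refine mul_le_mul_of_nonneg_left ?_ hγ.le
      have : ⟪gradient (f i) (y i), x - z⟫_ℝ =
          ⟪gradient (f i) (y i), x - y i⟫_ℝ - ⟪gradient (f i) (y i), z - y i⟫_ℝ := by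
        rw [← inner_sub_right]; congr 1; abel
      linarith
    rw [inner_sub_left] at h3
    rw [contribution, inner_sub_left, real_inner_smul_left]
    linarith
  have hsum := Finset.sum_le_sum fun i (_ : i ∈ Finset.univ) => hi i
  rw [← inner_average_eq hM] at hsum
  simp only [Finset.sum_sub_distrib, Finset.sum_add_distrib, ← Finset.mul_sum, Finset.sum_const,
    Finset.card_univ, Fintype.card_fin, nsmul_eq_mul] at hsum
  rw [inner_add_left] at hopt
  have hopt' := mul_le_mul_of_nonneg_left hopt hM'.le
  refine le_of_mul_le_mul_left ?_ hM'
  simp only [realObjective]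
  have e : ∀ S : ℝ, (M : ℝ) * (1 / (M : ℝ) * S) = S := fun S => by field_simp
  calc _ = M * bregman h x z + γ * ((M * (1 / (M : ℝ) * ∑ i, f i z)) + M * (g z).toReal
        - M * (1 / (M : ℝ) * ∑ i, f i x) - M * (g x).toReal)
        + (1 - γ * L) * (M * (1 / (M : ℝ) * ∑ i, bregman h z (y i))) := by ring
    _ ≤ _ := by
      rw [e, e, e, e]
      linarith

/-- The step from contributions computed at interior points has a minimizer. -/
lemma argminOn_stepObjective_nonempty (hM : 0 < M) (hL : 0 < L) (hpb : ProblemAssumption X g)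
    (hreg : IsBregmanRegularizer X h) (hf : ∀ i, IsRelSmooth X h L (f i)) (hγ : 0 < γ)
    (hγL : γ * L < 1) {B : ℝ} (hB : ∀ x ∈ X, x ∈ effDom g → B ≤ realObjective f g x)
    {y : Fin M → EuclideanSpace ℝ (Fin n)} (hy : ∀ i, y i ∈ interior X) :
    (argminOn X (stepObjective g h γ
      ((1 / (M : ℝ)) • ∑ i, contribution f h γ i (y i)))).Nonempty := by
  have hM' : (0 : ℝ) < M := by exact_mod_cast hM
  set u := (1 / (M : ℝ)) • ∑ i, contribution f h γ i (y i) with hu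
  set j : Fin M := ⟨0, hM⟩
  set K : ℝ := ∑ i, ((h (y i)).toReal + ⟪contribution f h γ i (y i), y i⟫_ℝ - γ * f i (y i))
    with hK
  -- Bounding each `γ * f i` above by the descent inequality costs only `γ L` of each distance; one
  -- of the remaining nonnegative distances suffices for coercivity.
  have hlow : ∀ x ∈ X, x ∈ effDom g →
      (1 - γ * L) * bregman h x (y j) + (K + M * (γ * B)) ≤ M * realStepObjective g h γ u x := by
    intro x hx hxg
    have hi : ∀ i, (1 - γ * L) * bregman h x (y i) + γ * f i x +
        ((h (y i)).toReal + ⟪contribution f h γ i (y i), y i⟫_ℝ - γ * f i (y i)) ≤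
          (h x).toReal + ⟪contribution f h γ i (y i), x⟫_ℝ := by
      intro i
      have h2 := mul_le_mul_of_nonneg_left ((hf i).descent hpb.convex hreg hL.le hx (hy i)) hγ.le
      simp only [contribution, bregman, inner_sub_left, inner_sub_right, real_inner_smul_left]
        at h2 ⊢
      linarith
    have hsum := Finset.sum_le_sum fun i (_ : i ∈ Finset.univ) => hi i
    rw [Finset.sum_add_distrib, Finset.sum_add_distrib, Finset.sum_add_distrib, ← hK,
      ← inner_average_eq hM, ← hu, ← Finset.mul_sum, ← Finset.mul_sum] at hsum
    simp only [Finset.sum_const, Finset.card_univ, Fintype.card_fin, nsmul_eq_mul] at hsum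
    have hj : bregman h x (y j) ≤ ∑ i, bregman h x (y i) :=
      Finset.single_le_sum (f := fun i => bregman h x (y i))
        (fun i _ => hreg.bregman_nonneg hx (hy i)) (Finset.mem_univ j)
    have hj' := mul_le_mul_of_nonneg_left hj (sub_nonneg.2 hγL.le)
    have hF := mul_le_mul_of_nonneg_left (hB x hx hxg) (mul_pos hM' hγ).le
    have e : (M : ℝ) * γ * realObjective f g x = γ * ∑ i, f i x + M * (γ * (g x).toReal) := by
      rw [realObjective]; field_simp
    rw [realStepObjective]
    linarith
  obtain ⟨c, hc, r, hr, hcoer⟩ := hreg.bregman_coercive (hy j)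
  obtain ⟨p, hpg, hpX⟩ := hpb.dom_nonempty
  have hc' : 0 < (1 - γ * L) * c := mul_pos (sub_pos.2 hγL) hc
  -- The ball contains the competitor `p`, and outside it the lower bound `hlow` already exceeds the
  -- value at `p`.
  set R : ℝ := max (max r ‖p - y j‖)
    ((M * realStepObjective g h γ u p - (K + M * (γ * B))) / ((1 - γ * L) * c)) with hR
  have hcomp : IsCompact (X ∩ Metric.closedBall (y j) R) :=
    (isCompact_closedBall _ _).inter_left hpb.closed
  have hpball : p ∈ X ∩ Metric.closedBall (y j) R :=
    ⟨hpX, mem_closedBall_iff_norm.2 ((le_max_right _ _).trans (le_max_left _ _))⟩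
  obtain ⟨z, hz, hzmin⟩ := LowerSemicontinuousOn.exists_isMinOn ⟨p, hpball⟩ hcomp
    ((lowerSemicontinuous_stepObjective hpb hreg hγ u).lowerSemicontinuousOn _)
  refine ⟨z, hz.1, fun x hx => ?_⟩
  by_cases hxb : x ∈ Metric.closedBall (y j) R
  · exact hzmin ⟨hx, hxb⟩
  by_cases hxg : x ∈ effDom g
  · refine (hzmin hpball).trans ?_
    rw [stepObjective_eq_coe hreg hpb.g_proper hpX hpg,
      stepObjective_eq_coe hreg hpb.g_proper hx hxg, EReal.coe_le_coe_iff]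
    rw [mem_closedBall_iff_norm, not_le] at hxb
    have h1 := hcoer x hx (((le_max_left _ _).trans (le_max_left _ _)).trans hxb.le)
    have h2 := (le_max_right _ _).trans hxb.le
    rw [div_le_iff₀ hc'] at h2
    have h3 := mul_le_mul_of_nonneg_left h1 (sub_nonneg.2 hγL.le)
    have h4 := hlow x hx hxg
    refine le_of_mul_le_mul_left ?_ hM'
    linarith
  · rw [stepObjective_eq_top hreg hγ hx hxg]
    exact le_top

end Step

/-! ### Delays and epochs -/

section ScheduleLemmas

variable {M : ℕ} {w : ℕ → Fin M}

/-- The evaluation point of a held contribution is thus strictly older than `k`, which makes the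
recursion causal and the strong inductions work. -/
lemma one_le_delay2 (w : ℕ → Fin M) (i : Fin M) (k : ℕ) : 1 ≤ delay2 w i k :=
  Nat.le_add_left _ _

/-- The index `k - D_i^k` never moves backwards: an exchange resets the first delay and makes the
previous one the second; otherwise only the first delay grows, by one. -/
lemma delay2_succ_le (w : ℕ → Fin M) (i : Fin M) (k : ℕ) :
    delay2 w i (k + 1) ≤ delay2 w i k + 1 := by
  have hle : lastExchange w i k ≤ k := by
    induction k with
    | zero => exact le_rfl
    | succ k ih => rw [lastExchange]; split_ifs <;> omega
  by_cases hw : w (k + 1) = i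
  · have h1 : delay w i (k + 1) = 0 := by simp [delay, lastExchange, hw]
    simp only [delay2, h1, Nat.sub_zero, Nat.add_sub_cancel]
    omega
  · have h1 : delay w i (k + 1) = delay w i k + 1 := by
      simp only [delay, lastExchange, hw, if_false]
      omega
    have h2 : k + 1 - (delay w i k + 1) - 1 = k - delay w i k - 1 := by omega
    simp only [delay2, h1, h2]
    omega

lemma epochState_snd_le (w : ℕ → Fin M) (k : ℕ) : (epochState w k).2 ≤ k := by
  induction k with
  | zero => exact le_rfl
  | succ k ih =>
    rw [epochState]
    split_ifs
    · exact le_rfl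
    · exact ih.trans k.le_succ

/-- Each new epoch starts strictly later than the previous one, so the epoch number is a lower bound
for its start. -/
lemma epoch_le_epochState_snd (w : ℕ → Fin M) (k : ℕ) : epoch w k ≤ (epochState w k).2 := by
  unfold epoch
  induction k with
  | zero => exact le_rfl
  | succ k ih =>
    rw [epochState]
    split_ifs
    · exact Nat.succ_le_succ (ih.trans (epochState_snd_le w k))
    · exact ih

/-- From epoch `m + 1` on, all held contributions were computed at iterates of index at least `m`. -/
lemma add_delay2_le_of_lt_epoch (i : Fin M) {m k : ℕ} (hm : m < epoch w k) :
    m + delay2 w i k ≤ k := by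
  induction k with
  | zero => exact absurd hm (Nat.not_lt_zero m)
  | succ k ih =>
    have h1 := epoch_le_epochState_snd w k
    have h2 := delay2_succ_le w i k
    -- At the start of an epoch, the defining condition places the evaluation points after the
    -- previous start; within an epoch, `delay2_succ_le` preserves the bound.
    by_cases hinc : ∀ i, (epochState w k).2 + delay2 w i (k + 1) ≤ k + 1
    · have h3 : epoch w (k + 1) = epoch w k + 1 := by simp only [epoch, epochState, if_pos hinc]
      have := hinc i
      omega
    · have h3 : epoch w (k + 1) = epoch w k := by simp only [epoch, epochState, if_neg hinc]
      have := ih (h3 ▸ hm)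
      omega

lemma eventually_add_delay2_le (hw : Tendsto (epoch w) atTop atTop) (m : ℕ) :
    ∀ᶠ k in atTop, ∀ i, m + delay2 w i k ≤ k := by
  filter_upwards [hw.eventually_gt_atTop m] with k hk i
  exact add_delay2_le_of_lt_epoch i hk

lemma tendsto_sub_delay2 (hw : Tendsto (epoch w) atTop atTop) (i : Fin M) :
    Tendsto (fun k => k - delay2 w i k) atTop atTop := by
  refine tendsto_atTop.2 fun m => ?_
  filter_upwards [eventually_add_delay2_le hw m] with k hk
  have := hk i
  omega

end ScheduleLemmas

/-! ### Causal recursion, and sequences dominated by averages of their past -/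

/-- The sequence whose `k`-th term is `Φ k` of the sequence of its previous terms. -/
noncomputable def causalSeq {α : Type*} (a : α) (Φ : ℕ → (ℕ → α) → α) : ℕ → α
  | k => Φ k (fun j => if _ : j < k then causalSeq a Φ j else a)

/-- As `Φ k` reads only earlier terms, the filler `a` at the other indices is immaterial. -/
lemma causalSeq_eq {α : Type*} (a : α) (Φ : ℕ → (ℕ → α) → α)
    (hΦ : ∀ k (p q : ℕ → α), (∀ j < k, p j = q j) → Φ k p = Φ k q) (k : ℕ) :
    causalSeq a Φ k = Φ k (causalSeq a Φ) := by
  rw [causalSeq]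
  exact hΦ k _ _ fun j hj => by rw [dif_pos hj]

/-- If `a k + e k` is eventually at most an average of the terms of `a` at indices that tend to
infinity, then along some subsequence `a` tends to its upper limit and `e` is eventually small. -/
lemma exists_subseq_tendsto_limsup {M : ℕ} (hM : 0 < M) {a e : ℕ → ℝ} {σ : Fin M → ℕ → ℕ}
    (hσ : ∀ i, Tendsto (σ i) atTop atTop) {B C : ℝ} (hB : ∀ k, B ≤ a k) (hC : ∀ k, a k ≤ C)
    (hae : ∀ᶠ k in atTop, a k + e k ≤ 1 / (M : ℝ) * ∑ i, a (σ i k)) :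
    ∃ φ : ℕ → ℕ, StrictMono φ ∧ Tendsto (a ∘ φ) atTop (𝓝 (limsup a atTop)) ∧
      ∀ j, e (φ j) ≤ 2 * (1 / ((j : ℝ) + 1)) := by
  have hM' : (0 : ℝ) < M := by exact_mod_cast hM
  have hbdd : IsBoundedUnder (· ≤ ·) atTop a := isBoundedUnder_of ⟨C, hC⟩
  have hcobdd : IsCoboundedUnder (· ≤ ·) atTop a :=
    (isBoundedUnder_of (r := (· ≥ ·)) ⟨B, hB⟩).isCoboundedUnder_le
  set A := limsup a atTop with hA
  obtain ⟨φ, hφ, hφP⟩ := extraction_forall_of_frequently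
    (P := fun j k => (A - 1 / ((j : ℝ) + 1) < a k ∧ a k < A + 1 / ((j : ℝ) + 1)) ∧
      e k ≤ 2 * (1 / ((j : ℝ) + 1))) (fun j => by
    have hj : (0 : ℝ) < 1 / ((j : ℝ) + 1) := Nat.one_div_pos_of_nat
    have h1 : ∃ᶠ k in atTop, A - 1 / ((j : ℝ) + 1) < a k :=
      frequently_lt_of_lt_limsup hcobdd (by linarith)
    have h2 : ∀ᶠ k in atTop, a k < A + 1 / ((j : ℝ) + 1) :=
      eventually_lt_of_limsup_lt (by linarith) hbdd
    have h3 : ∀ᶠ k in atTop, ∀ i, a (σ i k) < A + 1 / ((j : ℝ) + 1) :=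
      eventually_all.2 fun i => (hσ i).eventually h2
    -- At such `k` the average is at most `A + 1 / (j + 1)` and `a k` exceeds `A - 1 / (j + 1)`; the
    -- difference bounds `e k`.
    refine (h1.and_eventually (h2.and (h3.and hae))).mono ?_
    rintro k ⟨k1, k2, k3, k4⟩
    refine ⟨⟨k1, k2⟩, ?_⟩
    have h5 : ∑ i, a (σ i k) ≤ M * (A + 1 / ((j : ℝ) + 1)) := by
      have := Finset.sum_le_card_nsmul Finset.univ (fun i => a (σ i k)) _ fun i _ => (k3 i).le
      simpa only [Finset.card_univ, Fintype.card_fin, nsmul_eq_mul] using this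
    have h6 : 1 / (M : ℝ) * ∑ i, a (σ i k) ≤ A + 1 / ((j : ℝ) + 1) := by
      rw [one_div, inv_mul_le_iff₀ hM']
      exact h5
    linarith)
  refine ⟨φ, hφ, ?_, fun j => (hφP j).2⟩
  have h0 : Tendsto (fun j : ℕ => 1 / ((j : ℝ) + 1)) atTop (𝓝 0) :=
    tendsto_one_div_add_atTop_nhds_zero_nat
  exact tendsto_of_tendsto_of_tendsto_of_le_of_le (by simpa using h0.const_sub A)
    (by simpa using h0.const_add A) (fun j => (hφP j).1.1.le) fun j => (hφP j).1.2.le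

/-- A nonnegative sequence that is eventually at most an average of earlier terms is bounded. -/
lemma exists_forall_le_of_le_average {M : ℕ} (hM : 0 < M) {a : ℕ → ℝ} {σ : Fin M → ℕ → ℕ}
    (ha : ∀ k, 0 ≤ a k) (hσ : ∀ᶠ k in atTop, ∀ i, σ i k < k)
    (hae : ∀ᶠ k in atTop, a k ≤ 1 / (M : ℝ) * ∑ i, a (σ i k)) : ∃ C, ∀ k, a k ≤ C := by
  have hM' : (0 : ℝ) < M := by exact_mod_cast hM
  obtain ⟨K, hK⟩ := eventually_atTop.1 (hσ.and hae)
  -- By nonnegativity this sum dominates each of the first `K` terms, and averaging preserves the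
  -- bound afterwards.
  refine ⟨∑ j ∈ Finset.range K, a j, fun k => ?_⟩
  induction k using Nat.strong_induction_on with
  | _ k ih =>
    rcases lt_or_ge k K with hk | hk
    · exact Finset.single_le_sum (fun j _ => ha j) (Finset.mem_range.2 hk)
    · obtain ⟨h1, h2⟩ := hK k hk
      refine h2.trans ?_
      rw [one_div, inv_mul_le_iff₀ hM']
      have := Finset.sum_le_card_nsmul Finset.univ (fun i => a (σ i k)) _ fun i _ => ih _ (h1 i)
      simpa using this

/-! ### Well-posedness and convergence of the iterates -/

section Convergence

variable {n M : ℕ} {X : Set (EuclideanSpace ℝ (Fin n))} {f : Fin M → EuclideanSpace ℝ (Fin n) → ℝ}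
  {g h : EuclideanSpace ℝ (Fin n) → EReal} {L γ : ℝ} {w : ℕ → Fin M}

lemma aggregate_congr {u0 : Fin M → EuclideanSpace ℝ (Fin n)} {k : ℕ}
    {x x' : ℕ → EuclideanSpace ℝ (Fin n)} (hx : ∀ j < k, x j = x' j) :
    aggregate f h γ w u0 x k = aggregate f h γ w u0 x' k := by
  rw [aggregate, aggregate]
  congr 1
  refine Finset.sum_congr rfl fun i _ => ?_
  rw [heldContribution, heldContribution]
  split_ifs with hk
  · rw [hx _ (by have := one_le_delay2 w i k; omega)]
  · rfl

/-- With this initialization a worker that has not answered counts as evaluated at `x0`, so the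
existence argument for a step applies from the first iteration. -/
lemma aggregate_contribution (x0 : EuclideanSpace ℝ (Fin n))
    (x : ℕ → EuclideanSpace ℝ (Fin n)) (k : ℕ) :
    aggregate f h γ w (fun i => contribution f h γ i x0) x k = (1 / (M : ℝ)) •
      ∑ i, contribution f h γ i (if delay2 w i k ≤ k then x (k - delay2 w i k) else x0) := by
  rw [aggregate]
  congr 1
  refine Finset.sum_congr rfl fun i _ => ?_
  rw [heldContribution]
  split_ifs <;> rfl

lemma IsAsyncBregman.mem_interior (hpb : ProblemAssumption X g) (hreg : IsBregmanRegularizer X h)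
    (hγ : 0 < γ) {x0 : EuclideanSpace ℝ (Fin n)} (hx0 : x0 ∈ interior X)
    {u0 : Fin M → EuclideanSpace ℝ (Fin n)} {x : ℕ → EuclideanSpace ℝ (Fin n)}
    (hx : IsAsyncBregman X f g h γ w x0 u0 x) (k : ℕ) : x k ∈ interior X := by
  rcases Nat.eq_zero_or_pos k with rfl | hk
  · rwa [hx.1]
  · exact argminOn_stepObjective_subset_interior hpb hreg hγ _ (hx.2 k hk)

lemma IsAsyncBregman.unique (hpb : ProblemAssumption X g) (hreg : IsBregmanRegularizer X h)
    (hγ : 0 < γ) {x0 : EuclideanSpace ℝ (Fin n)}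
    {u0 : Fin M → EuclideanSpace ℝ (Fin n)} {x x' : ℕ → EuclideanSpace ℝ (Fin n)}
    (hx : IsAsyncBregman X f g h γ w x0 u0 x) (hx' : IsAsyncBregman X f g h γ w x0 u0 x') :
    x = x' := by
  funext k
  induction k using Nat.strong_induction_on with
  | _ k ih =>
    rcases Nat.eq_zero_or_pos k with rfl | hk
    · rw [hx.1, hx'.1]
    · have h1 := hx.2 k hk
      rw [aggregate_congr ih] at h1
      exact argminOn_stepObjective_subsingleton hpb hreg hγ _ h1 (hx'.2 k hk)

lemma exists_isAsyncBregman (hM : 0 < M) (hL : 0 < L) (hpb : ProblemAssumption X g)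
    (hreg : IsBregmanRegularizer X h) (hf : ∀ i, IsRelSmooth X h L (f i)) (hγ : 0 < γ)
    (hγL : γ * L < 1) {B : ℝ} (hB : ∀ x ∈ X, x ∈ effDom g → B ≤ realObjective f g x)
    {x0 : EuclideanSpace ℝ (Fin n)} (hx0 : x0 ∈ interior X) :
    ∃ x, IsAsyncBregman X f g h γ w x0 (fun i => contribution f h γ i x0) x := by
  classical
  set u0 : Fin M → EuclideanSpace ℝ (Fin n) := fun i => contribution f h γ i x0
  -- The selection is total, with `x0` as default, because a step is known to have a minimizer only
  -- once the earlier iterates are known to be interior.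
  have hsel : ∀ u, ∃ z, (argminOn X (stepObjective g h γ u)).Nonempty →
      z ∈ argminOn X (stepObjective g h γ u) := by
    intro u
    by_cases hu : (argminOn X (stepObjective g h γ u)).Nonempty
    · exact ⟨hu.some, fun _ => hu.some_mem⟩
    · exact ⟨x0, fun hu' => (hu hu').elim⟩
  choose S hS using hsel
  set Φ : ℕ → (ℕ → EuclideanSpace ℝ (Fin n)) → EuclideanSpace ℝ (Fin n) :=
    fun k p => if k = 0 then x0 else S (aggregate f h γ w u0 p k) with hΦ
  have heq := causalSeq_eq x0 Φ fun k p q hpq => by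
    simp only [hΦ]
    rw [aggregate_congr hpq]
  set x := causalSeq x0 Φ
  have h0 : x 0 = x0 := heq 0
  have hmem : ∀ k, 1 ≤ k → (∀ j < k, x j ∈ interior X) →
      x k ∈ argminOn X (stepObjective g h γ (aggregate f h γ w u0 x k)) := by
    intro k hk hj
    have hxk : x k = S (aggregate f h γ w u0 x k) := by
      rw [heq k]; exact if_neg (Nat.one_le_iff_ne_zero.1 hk)
    rw [hxk]
    apply hS
    rw [aggregate_contribution]
    refine argminOn_stepObjective_nonempty hM hL hpb hreg hf hγ hγL hB fun i => ?_
    split_ifs with hd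
    · exact hj _ (by have := one_le_delay2 w i k; omega)
    · exact hx0
  have hint : ∀ k, x k ∈ interior X := by
    intro k
    induction k using Nat.strong_induction_on with
    | _ k ih =>
      rcases Nat.eq_zero_or_pos k with rfl | hk
      · rwa [h0]
      · exact argminOn_stepObjective_subset_interior hpb hreg hγ _ (hmem k hk ih)
  exact ⟨x, h0, fun k hk => hmem k hk fun j _ => hint j⟩

lemma lowerSemicontinuousOn_objective (hpb : ProblemAssumption X g)
    (hf : ∀ i, LowerSemicontinuousOn (f i) X) : LowerSemicontinuousOn (objective f g) X := by
  have h1 : LowerSemicontinuousOn (fun z => ∑ i, f i z) X :=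
    lowerSemicontinuousOn_sum fun i _ => hf i
  have hc : Continuous (fun s : ℝ => ((1 / (M : ℝ) * s : ℝ) : EReal)) :=
    continuous_coe_real_ereal.comp (by fun_prop)
  have h2 := hc.comp_lowerSemicontinuousOn h1 fun s t hst =>
    EReal.coe_le_coe_iff.2 (mul_le_mul_of_nonneg_left hst (by positivity))
  exact h2.add' (hpb.g_lsc.lowerSemicontinuousOn X) fun z _ =>
    EReal.continuousAt_add (Or.inl (EReal.coe_ne_top _)) (Or.inl (EReal.coe_ne_bot _))

/-- Limits of sequences in `X` along which the objective approaches its minimum are minimizers. -/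
lemma mem_argminOn_objective_of_tendsto (hpb : ProblemAssumption X g)
    (hf : ∀ i, LowerSemicontinuousOn (f i) X) {xstar : EuclideanSpace ℝ (Fin n)}
    (hstar : xstar ∈ argminOn X (objective f g)) {x : ℕ → EuclideanSpace ℝ (Fin n)}
    {xbar : EuclideanSpace ℝ (Fin n)} (hx : Tendsto x atTop (𝓝 xbar)) (hxX : ∀ k, x k ∈ X)
    (hxg : ∀ᶠ k in atTop, x k ∈ effDom g) {δ : ℕ → ℝ} (hδ : Tendsto δ atTop (𝓝 0))
    (hle : ∀ᶠ k in atTop, realObjective f g (x k) ≤ realObjective f g xstar + δ k) :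
    xbar ∈ argminOn X (objective f g) := by
  have hbar : xbar ∈ X := hpb.closed.mem_of_tendsto hx (Eventually.of_forall hxX)
  refine ⟨hbar, fun y hy => le_trans ?_ (hstar.2 y hy)⟩
  have hsg := ((mem_argminOn_objective_iff hpb).1 hstar).2.1
  rw [objective_eq_coe hpb.g_proper hsg]
  by_contra! hlt
  obtain ⟨c, hc1, hc2⟩ := EReal.lt_iff_exists_real_btwn.1 hlt
  have hx' : Tendsto x atTop (𝓝[X] xbar) :=
    tendsto_nhdsWithin_iff.2 ⟨hx, Eventually.of_forall hxX⟩
  have hev : ∀ᶠ k in atTop, c ≤ realObjective f g xstar + δ k := by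
    filter_upwards [hx'.eventually (lowerSemicontinuousOn_objective hpb hf xbar hbar _ hc2), hxg,
      hle] with k h1 h2 h3
    rw [objective_eq_coe hpb.g_proper h2] at h1
    exact (EReal.coe_lt_coe_iff.1 h1).le.trans h3
  have := ge_of_tendsto (by simpa using hδ.const_add (realObjective f g xstar)) hev
  exact (EReal.coe_lt_coe_iff.1 hc1).not_ge this

lemma IsAsyncBregman.tendsto (hM : 0 < M) (hL : 0 < L) (hpb : ProblemAssumption X g)
    (hreg : IsBregmanRegularizer X h) (hf : ∀ i, IsRelSmooth X h L (f i))
    (hlev : LevelBoundedLimit h) (hγ : 0 < γ) (hγL : γ * L < 1)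
    (hw : Tendsto (epoch w) atTop atTop) {xstar : EuclideanSpace ℝ (Fin n)}
    (hstar : argminOn X (objective f g) = {xstar})
    {x0 : EuclideanSpace ℝ (Fin n)} (hx0 : x0 ∈ interior X)
    {u0 : Fin M → EuclideanSpace ℝ (Fin n)} {x : ℕ → EuclideanSpace ℝ (Fin n)}
    (hx : IsAsyncBregman X f g h γ w x0 u0 x) : Tendsto x atTop (𝓝 xstar) := by
  have hint : ∀ k, x k ∈ interior X := hx.mem_interior hpb hreg hγ hx0
  have hmemstar : xstar ∈ argminOn X (objective f g) := hstar ▸ mem_singleton xstar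
  obtain ⟨hsX, hsg, hsmin⟩ := (mem_argminOn_objective_iff hpb).1 hmemstar
  have hlimit := hlev.limit_iff xstar (by rwa [hreg.dom_eq])
  have hbounded := hlev.level_bounded xstar (by rwa [hreg.dom_eq])
  rw [hreg.dom_eq] at hlimit hbounded
  have hxg : ∀ k, 1 ≤ k → x k ∈ effDom g := fun k hk =>
    ((mem_argminOn_stepObjective_iff hpb hreg hγ).1 (hx.2 k hk)).2.1
  set a : ℕ → ℝ := fun k => bregman h xstar (x k) with ha_def
  set e : ℕ → ℝ := fun k => γ * (realObjective f g (x k) - realObjective f g xstar) with he_def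
  set σ : Fin M → ℕ → ℕ := fun i k => k - delay2 w i k with hσ_def
  have ha : ∀ k, 0 ≤ a k := fun k => hreg.bregman_nonneg hsX (hint k)
  have hae : ∀ᶠ k in atTop, a k + e k ≤ 1 / (M : ℝ) * ∑ i, a (σ i k) := by
    -- The case `m = 0` says that every worker has answered; from then on the initial vectors have
    -- disappeared.
    filter_upwards [eventually_ge_atTop 1, eventually_add_delay2_le hw 0] with k hk hd
    have hagg : aggregate f h γ w u0 x k =
        (1 / (M : ℝ)) • ∑ i, contribution f h γ i (x (σ i k)) := by
      rw [aggregate]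
      congr 1
      refine Finset.sum_congr rfl fun i _ => ?_
      rw [heldContribution, if_pos (by simpa using hd i)]
    have hz := hx.2 k hk
    rw [hagg] at hz
    have hb := step_bound hM hL hpb hreg hf hγ (fun i => hint (σ i k)) hz hsX hsg
    have hnn : 0 ≤ (1 - γ * L) * (1 / (M : ℝ) * ∑ i, bregman h (x k) (x (σ i k))) :=
      mul_nonneg (sub_nonneg.2 hγL.le) (mul_nonneg (by positivity) (Finset.sum_nonneg fun i _ =>
        hreg.bregman_nonneg (interior_subset (hint k)) (hint _)))
    simp only [ha_def, he_def]
    linarith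
  obtain ⟨C, hC⟩ : ∃ C, ∀ k, a k ≤ C := by
    refine exists_forall_le_of_le_average hM (σ := σ) ha ?_ ?_
    · filter_upwards [eventually_add_delay2_le hw 0] with k hk i
      have h1 := hk i
      have h2 := one_le_delay2 w i k
      simp only [hσ_def]
      omega
    · filter_upwards [hae, eventually_ge_atTop 1] with k hk hk1
      have : 0 ≤ e k := mul_nonneg hγ.le
        (sub_nonneg.2 (hsmin (x k) (interior_subset (hint k)) (hxg k hk1)))
      linarith
  obtain ⟨φ, hφ, hφa, hφe⟩ :=
    exists_subseq_tendsto_limsup hM (tendsto_sub_delay2 hw) ha hC hae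
  obtain ⟨xbar, -, ψ, hψ, hlim⟩ := tendsto_subseq_of_bounded (hbounded C)
    (x := x ∘ φ) fun j => ⟨hint _, hC _⟩
  have hδ : Tendsto (fun j => 2 * (1 / ((ψ j : ℝ) + 1)) / γ) atTop (𝓝 0) := by
    have h1 := (tendsto_one_div_add_atTop_nhds_zero_nat (𝕜 := ℝ)).comp hψ.tendsto_atTop
    simpa using (h1.const_mul 2).div_const γ
  have hbar : xbar ∈ argminOn X (objective f g) := by
    refine mem_argminOn_objective_of_tendsto hpb (fun i => (hf i).lsc) hmemstar hlim
      (fun j => interior_subset (hint _)) ?_ hδ (Eventually.of_forall fun j => ?_)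
    · exact ((hφ.comp hψ).tendsto_atTop.eventually_ge_atTop 1).mono fun j => hxg _
    · have h1 := hφe (ψ j)
      have h2 : realObjective f g (x (φ (ψ j))) - realObjective f g xstar ≤
          2 * (1 / ((ψ j : ℝ) + 1)) / γ := by
        rw [le_div_iff₀ hγ, mul_comm]
        exact h1
      simp only [Function.comp_apply]
      linarith
  have hbar_eq : xbar = xstar := by rwa [hstar] at hbar
  rw [hbar_eq] at hlim
  -- The same subsequence of `a` tends to its upper limit by construction and to `0` because its
  -- iterates tend to `x⋆`.
  have hzero : limsup a atTop = 0 :=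
    tendsto_nhds_unique (hφa.comp hψ.tendsto_atTop) ((hlimit _ fun j => hint _).1 hlim)
  refine (hlimit x hint).2 (tendsto_order.2 ⟨fun c hc => Eventually.of_forall fun k =>
    hc.trans_le (ha k), fun c hc => ?_⟩)
  exact eventually_lt_of_limsup_lt (hzero.trans_lt hc) (isBoundedUnder_of ⟨C, hC⟩)

end Convergence

theorem theorem1 {n M : ℕ} (hM : 0 < M)
    (X : Set (EuclideanSpace ℝ (Fin n)))
    (f : Fin M → EuclideanSpace ℝ (Fin n) → ℝ)
    (g h : EuclideanSpace ℝ (Fin n) → EReal)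
    (L γ : ℝ) (hL : 0 < L) (hγ : γ ∈ Set.Ioo 0 (1 / L))
    (hpb : ProblemAssumption X g)
    (hreg : IsBregmanRegularizer X h)
    (hf : ∀ i, IsRelSmooth X h L (f i))
    (hlev : LevelBoundedLimit h)
    (w : ℕ → Fin M) (hw : Tendsto (epoch w) atTop atTop)
    (xstar : EuclideanSpace ℝ (Fin n)) (hstar : argminOn X (objective f g) = {xstar})
    (x0 : EuclideanSpace ℝ (Fin n)) (hx0 : x0 ∈ interior X) :
    (∃! x : ℕ → EuclideanSpace ℝ (Fin n),
      IsAsyncBregman X f g h γ w x0 (fun i => contribution f h γ i x0) x) ∧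
    ∀ (u0 : Fin M → EuclideanSpace ℝ (Fin n)) (x : ℕ → EuclideanSpace ℝ (Fin n)),
      IsAsyncBregman X f g h γ w x0 u0 x →
        (∀ k, x k ∈ interior X) ∧ Tendsto x atTop (𝓝 xstar) := by
  have hγL : γ * L < 1 := (lt_div_iff₀ hL).1 hγ.2
  refine ⟨?_, fun u0 x hx => ⟨hx.mem_interior hpb hreg hγ.1 hx0,
    hx.tendsto hM hL hpb hreg hf hlev hγ.1 hγL hw hstar hx0⟩⟩
  have hmem : xstar ∈ argminOn X (objective f g) := hstar ▸ mem_singleton xstar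
  -- The lower bound `B` for the objective is its value at `xstar`.
  obtain ⟨x, hx⟩ := exists_isAsyncBregman hM hL hpb hreg hf hγ.1 hγL (w := w)
    ((mem_argminOn_objective_iff hpb).1 hmem).2.2 hx0
  exact ⟨x, hx, fun x' hx' => hx'.unique hpb hreg hγ.1 hx⟩
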